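/- Let $G$ be a finite-dimensional real Lie group with identity $e$ and Lie algebra $\mathfrak g=T_eG$, with bracket $[x,y]=[\tilde x,\tilde y]_e$, where $\tilde x$ denotes the left-invariant vector field with $\tilde x_e=x$. For $g\in G$ let $L_g:h\mapsto gh$ be the left translation, and write $dL_g:\mathfrak g\to T_gG$ for its differential at $e$. Let $\langle\cdot,\cdot\rangle$ be a smooth left-invariant Riemannian metric on $G$ and let $\nabla$ be its Levi-Civita connection. For $x\in\mathfrak g$ let $\mathrm{ad}_x^*$ be the adjoint of $\mathrm{ad}_x=[x,\cdot]$ for the inner product on $\mathfrak g$, i.e. $\langle \mathrm{ad}_x^*y,z\rangle=\langle y,[x,z]\rangle$ for all $y,z\in\mathfrak g$, and put $$\alpha(x,y)=\tfrac12\big([x,y]-\mathrm{ad}_x^*y-\mathrm{ad}_y^*x\big),\qquad x,y\in\mathfrak g.$$ Let $J\subseteq\mathbb R$ be an interval with more than one point (for example $J=[0,1]$), let $\gamma:J\to G$ be a smooth curve, and let $Y$ assign to each $t\in J$ a vector $Y(t)\in T_{\gamma(t)}G$. Define $\omega,\zeta:J\to\mathfrak g$ by $\omega(t)=dL_{\gamma(t)}^{-1}\dot\gamma(t)$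 and $\zeta(t)=dL_{\gamma(t)}^{-1}Y(t)$. Then $Y$ is parallel along $\gamma$, that is, $Y$ is a differentiable vector field along $\gamma$ whose covariant derivative along $\gamma$ satisfies $\nabla_{\dot\gamma(t)}Y(t)=0$ for all $t\in J$, if and only if $\zeta$ is differentiable on $J$ and $$\dot\zeta(t)=-\alpha(\omega(t),\zeta(t))\qquad\text{for all }t\in J.$$ (At an end point of $J$ that belongs to $J$, derivatives are one-sided.) -/

import Mathlib

open Set Bundle
open scoped Manifold ContDiff

noncomputable section

section Riemannian

variable {E : Type*} [NormedAddCommGroup E] [NormedSpace ℝ E] [FiniteDimensional ℝ E]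
  {H : Type*} [TopologicalSpace H] {I : ModelWithCorners ℝ E H}
  {M : Type*} [TopologicalSpace M] [ChartedSpace H M] [IsManifold I ∞ M]

/-- A connection `∇` on the tangent bundle is the Levi-Civita connection of the Riemannian metric `g`
if it is torsion-free and metric: `v ⟪σ, τ⟫ = ⟪∇_v σ, τ⟫ + ⟪σ, ∇_v τ⟫` at every point `x`, for
all `v ∈ T_x M` and all vector fields `σ`, `τ` that are differentiable at `x`. -/
structure IsLeviCivita (g : ContMDiffRiemannianMetric I ∞ E (fun x : M ↦ TangentSpace I x))
    (cov : CovariantDerivative I E (fun x : M ↦ TangentSpace I x)) : Prop where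
  torsion_eq_zero :
    haveI : CompleteSpace E := FiniteDimensional.complete ℝ E
    cov.torsion = 0
  metric : ∀ (x : M) (v : TangentSpace I x) (σ τ : ∀ y : M, TangentSpace I y),
    MDifferentiableAt I I.tangent (fun y ↦ (⟨y, σ y⟩ : TangentBundle I M)) x →
    MDifferentiableAt I I.tangent (fun y ↦ (⟨y, τ y⟩ : TangentBundle I M)) x →
    (d% (fun y ↦ g.inner y (σ y) (τ y)) x) v
      = g.inner x (cov σ x v) (τ x) + g.inner x (σ x) (cov τ x v)

/-- The velocity at time `t` of a curve defined on `J ⊆ ℝ`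
(one-sided at an end point of an interval `J`). -/
def velocityWithin (γ : ℝ → M) (J : Set ℝ) (t : ℝ) : TangentSpace I (γ t) :=
  mfderivWithin 𝓘(ℝ, ℝ) I γ J t (1 : ℝ)

/-- The covariant derivative at time `t` of a vector field `Y` along a curve `γ` defined on
`J ⊆ ℝ`. Write `Y = ∑ i, Yⁱ • sᵢ ∘ γ` near `t`, where `(sᵢ)` is the coordinate frame of the chart
at `γ t`; the covariant derivative is `∑ i, ((Yⁱ)' t • sᵢ + Yⁱ t • ∇_{γ' t} sᵢ)` at `γ t`. -/
def covDerivAlong (cov : CovariantDerivative I E (fun x : M ↦ TangentSpace I x))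
    (γ : ℝ → M) (J : Set ℝ) (Y : ∀ t : ℝ, TangentSpace I (γ t)) (t : ℝ) :
    TangentSpace I (γ t) :=
  let e := trivializationAt E (fun x : M ↦ TangentSpace I x) (γ t)
  let b := Module.finBasis ℝ E
  ∑ i, (derivWithin (fun s ↦ e.localFrameCoeff I b i (γ s) (Y s)) J t • e.localFrame b i (γ t)
    + e.localFrameCoeff I b i (γ t) (Y t) • cov (e.localFrame b i) (γ t) (velocityWithin γ J t))

/-- A vector field `Y` along a curve `γ` defined on `J ⊆ ℝ` is parallel if it is differentiable
and its covariant derivative along `γ` vanishes. -/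
structure IsParallelAlong (cov : CovariantDerivative I E (fun x : M ↦ TangentSpace I x))
    (γ : ℝ → M) (J : Set ℝ) (Y : ∀ t : ℝ, TangentSpace I (γ t)) : Prop where
  mdifferentiableOn :
    MDifferentiableOn 𝓘(ℝ, ℝ) I.tangent (fun t ↦ (⟨γ t, Y t⟩ : TangentBundle I M)) J
  covDerivAlong_eq_zero : ∀ t ∈ J, covDerivAlong cov γ J Y t = 0

end Riemannian

section LieGroup

variable {E : Type*} [NormedAddCommGroup E] [NormedSpace ℝ E]
  {H : Type*} [TopologicalSpace H] {I : ModelWithCorners ℝ E H}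
  {G : Type*} [TopologicalSpace G] [ChartedSpace H G] [Group G]

/-- The Maurer-Cartan form `v ∈ T_g G ↦ (d L_g)⁻¹ v ∈ 𝔤`, where `d L_g : 𝔤 → T_g G` is the
differential at the identity of the left translation by `g`. -/
def maurerCartan (g : G) (v : TangentSpace I g) : GroupLieAlgebra I G :=
  (mfderiv I I (fun h : G ↦ g * h) 1).inverse v

variable [LieGroup I ∞ G]

/-- The Riemannian metric `g` is left-invariant: left translations are isometries between tangent
spaces. -/
def IsLeftInvariantMetric
    (g : ContMDiffRiemannianMetric I ∞ E (fun x : G ↦ TangentSpace I x)) : Prop :=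
  ∀ (x h : G) (u v : TangentSpace I x),
    g.inner (h * x) (mfderiv I I (fun y : G ↦ h * y) x u) (mfderiv I I (fun y : G ↦ h * y) x v)
      = g.inner x u v

/-- The inner product on the Lie algebra given by a Riemannian metric, as a bilinear form. -/
def lieInner (g : ContMDiffRiemannianMetric I ∞ E (fun x : G ↦ TangentSpace I x)) :
    LinearMap.BilinForm ℝ (GroupLieAlgebra I G) :=
  LinearMap.mk₂ ℝ (fun x y ↦ g.inner 1 x y) (by simp) (by simp) (by simp) (by simp)

theorem lieInner_nondegenerate
    (g : ContMDiffRiemannianMetric I ∞ E (fun x : G ↦ TangentSpace I x)) :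
    (lieInner g).Nondegenerate := by
  refine ⟨fun x hx ↦ ?_, fun x hx ↦ ?_⟩ <;> by_contra h <;>
    exact (g.pos 1 x h).ne' (hx x)

variable [FiniteDimensional ℝ E]

/-- The map `ad_x = [x, ·]` on the Lie algebra of `G`. -/
def adLeft (x : GroupLieAlgebra I G) : Module.End ℝ (GroupLieAlgebra I G) :=
  haveI : CompleteSpace E := FiniteDimensional.complete ℝ E
  haveI : LieGroup I (minSmoothness ℝ 3) G :=
    LieGroup.of_le (n := ∞) (by simp; exact ENat.LEInfty.out)
  LieAlgebra.ad ℝ (GroupLieAlgebra I G) x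

/-- The metric adjoint `ad_x^*` of `ad_x`, for the inner product on the Lie algebra. -/
def adStar (g : ContMDiffRiemannianMetric I ∞ E (fun x : G ↦ TangentSpace I x))
    (x : GroupLieAlgebra I G) : Module.End ℝ (GroupLieAlgebra I G) :=
  haveI : FiniteDimensional ℝ (GroupLieAlgebra I G) := inferInstanceAs (FiniteDimensional ℝ E)
  (lieInner g).leftAdjointOfNondegenerate (lieInner_nondegenerate g) (adLeft x)

/-- The defining property `⟪ad_x^* y, z⟫ = ⟪y, [x, z]⟫` of the metric adjoint. -/
theorem inner_adStar (g : ContMDiffRiemannianMetric I ∞ E (fun x : G ↦ TangentSpace I x))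
    (x y z : GroupLieAlgebra I G) : g.inner 1 (adStar g x y) z = g.inner 1 y ⁅x, z⁆ :=
  haveI : FiniteDimensional ℝ (GroupLieAlgebra I G) := inferInstanceAs (FiniteDimensional ℝ E)
  LinearMap.BilinForm.isAdjointPairLeftAdjointOfNondegenerate (lieInner g)
    (lieInner_nondegenerate g) (adLeft x) y z

/-- The map `α(x, y) = ½ ([x, y] - ad_x^* y - ad_y^* x)` on the Lie algebra. -/
def reducedConnection (g : ContMDiffRiemannianMetric I ∞ E (fun x : G ↦ TangentSpace I x))
    (x y : GroupLieAlgebra I G) : GroupLieAlgebra I G :=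
  (1 / 2 : ℝ) • (⁅x, y⁆ - adStar g x y - adStar g y x)

end LieGroup

end

/-!
The equation `ζ' = -α(ω, ζ)` is the parallel transport equation written in a frame of left-invariant
vector fields. Three facts carry the argument.

* The covariant derivative along a curve may be computed in any frame, not only in the coordinate
  frame by which it is defined (`covDerivAlong_eq_sum`): if `Y = ∑ i, cⁱ • Xᵢ ∘ γ` for vector fields
  `Xᵢ` differentiable at `γ t`, then it equals `∑ i, ((cⁱ)' • Xᵢ + cⁱ • ∇_{γ'} Xᵢ)`, by the Leibniz
  rule applied to the coordinate expressions of the `Xᵢ`.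
* Writing `X_x` for the left-invariant field with value `x` at `1`, one has `∇_{X_x} X_y = X_{α(x, y)}`
  (`IsLeviCivita.cov_mulInvariantVectorField`). This is the Koszul formula, in which the derivatives
  of the inner products `⟪X_x, X_y⟫` vanish because these functions are constant.
* A vector field along a curve is differentiable exactly when its Maurer-Cartan transport `ζ` is.
  One direction expands `Y` in a left-invariant frame; for the other, the coordinates of `ζ` in the
  basis dual to `(bᵢ)` for the inner product on the Lie algebra are `⟪Y, X_{bᵢ} ∘ γ⟫`, which are
  differentiable since the metric is smooth
  (`IsLeftInvariantMetric.differentiableWithinAt_maurerCartan`).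

Together they give that the covariant derivative of `Y` along `γ` is the left translate of
`ζ' + α(ω, ζ)` (`covDerivAlong_eq_mulInvariantVectorField`), and left translation is injective.
-/

/-! ### The covariant derivative along a curve in an arbitrary family of fields -/

section CovariantDerivativeAlong

variable {E : Type*} [NormedAddCommGroup E] [NormedSpace ℝ E]
  {H : Type*} [TopologicalSpace H] {I : ModelWithCorners ℝ E H}
  {M : Type*} [TopologicalSpace M] [ChartedSpace H M] [IsManifold I ∞ M]
  {ι : Type*}

/-- The Leibniz rule for a finite linear combination of vector fields with function coefficients. -/
theorem CovariantDerivative.sum_smul_apply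
    (cov : CovariantDerivative I E (fun x : M ↦ TangentSpace I x))
    (s : Finset ι) {f : ι → M → ℝ} {X : ι → ∀ x : M, TangentSpace I x} {x : M}
    (hf : ∀ i ∈ s, MDifferentiableAt I 𝓘(ℝ, ℝ) (f i) x)
    (hX : ∀ i ∈ s, MDifferentiableAt I I.tangent (fun y ↦ (⟨y, X i y⟩ : TangentBundle I M)) x)
    (v : TangentSpace I x) :
    cov (fun y ↦ ∑ i ∈ s, f i y • X i y) x v
      = ∑ i ∈ s, (f i x • cov (X i) x v + (d% (f i) x) v • X i x) := by
  classical
  induction s using Finset.induction_on with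
  | empty =>
    have h := congr_fun (CovariantDerivative.zero cov) x
    have h0 : (fun y : M ↦ ∑ i ∈ (∅ : Finset ι), f i y • X i y) = 0 := by ext; simp
    rw [h0, h]
    simp
  | insert j s hj ih =>
    have hsplit : (fun y ↦ ∑ i ∈ insert j s, f i y • X i y)
        = (f j • X j) + fun y ↦ ∑ i ∈ s, f i y • X i y := by
      ext y
      simp [Finset.sum_insert hj]
    have hfj := hf j (Finset.mem_insert_self _ _)
    have hXj := hX j (Finset.mem_insert_self _ _)
    have hfs i (hi : i ∈ s) := hf i (Finset.mem_insert_of_mem hi)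
    have hXs i (hi : i ∈ s) := hX i (Finset.mem_insert_of_mem hi)
    have hsum : MDifferentiableAt I I.tangent
        (fun y ↦ (⟨y, ∑ i ∈ s, f i y • X i y⟩ : TangentBundle I M)) x :=
      .sum_section fun i hi ↦ (hfs i hi).smul_section (hXs i hi)
    rw [hsplit, cov.isCovariantDerivativeOnUniv.add (hfj.smul_section hXj) hsum,
      cov.isCovariantDerivativeOnUniv.leibniz hXj hfj, Finset.sum_insert hj, ← ih hfs hXs]
    rfl

variable [Fintype ι] {γ : ℝ → M} {J : Set ℝ} {t : ℝ}
  {c : ι → ℝ → ℝ} {c' : ι → ℝ} {X : ι → ∀ x : M, TangentSpace I x}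
  {Y : ∀ t : ℝ, TangentSpace I (γ t)}

theorem mdifferentiableWithinAt_of_eq_sum
    (hγ : MDifferentiableWithinAt 𝓘(ℝ, ℝ) I γ J t) (ht : t ∈ J)
    (hX : ∀ i, MDifferentiableAt I I.tangent (fun y ↦ (⟨y, X i y⟩ : TangentBundle I M)) (γ t))
    (hc : ∀ i, DifferentiableWithinAt ℝ (c i) J t)
    (hY : ∀ s ∈ J, Y s = ∑ i, c i s • X i (γ s)) :
    MDifferentiableWithinAt 𝓘(ℝ, ℝ) I.tangent (fun t ↦ (⟨γ t, Y t⟩ : TangentBundle I M)) J t := by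
  let e := trivializationAt E (fun x : M ↦ TangentSpace I x) (γ t)
  rw [mdifferentiableWithinAt_totalSpace]
  refine ⟨hγ, ?_⟩
  have hXe i : MDifferentiableWithinAt 𝓘(ℝ, ℝ) 𝓘(ℝ, E) (fun s ↦ (e ⟨γ s, X i (γ s)⟩).2) J t :=
    (((mdifferentiableAt_section _ _).1 (hX i)).comp_mdifferentiableWithinAt t hγ :)
  have hsum : DifferentiableWithinAt ℝ (fun s ↦ ∑ i, c i s • (e ⟨γ s, X i (γ s)⟩).2) J t :=
    .fun_sum fun i _ ↦ (hc i).smul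
      (mdifferentiableWithinAt_iff_differentiableWithinAt.1 (hXe i))
  refine hsum.mdifferentiableWithinAt.congr_of_eventuallyEq ?_ ?_
  · filter_upwards [self_mem_nhdsWithin, hγ.continuousWithinAt (e.open_baseSet.mem_nhds
      (FiberBundle.mem_baseSet_trivializationAt' (γ t)))] with s hs hse
    have hlin (v : TangentSpace I (γ s)) : (e ⟨γ s, v⟩).2 = e.linearEquivAt ℝ (γ s) hse v := rfl
    change (e ⟨γ s, Y s⟩).2 = _
    simp only [hlin, hY s hs, map_sum, map_smul]
  · have hse := FiberBundle.mem_baseSet_trivializationAt' (F := E)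
      (E := fun x : M ↦ TangentSpace I x) (γ t)
    have hlin (v : TangentSpace I (γ t)) : (e ⟨γ t, v⟩).2 = e.linearEquivAt ℝ (γ t) hse v := rfl
    change (e ⟨γ t, Y t⟩).2 = _
    simp only [hlin, hY t ht, map_sum, map_smul]

/-- The covariant derivative along a curve can be computed from any expression of the vector field
as a combination of vector fields on the manifold; the coordinate frame plays no special role. -/
theorem covDerivAlong_eq_sum [FiniteDimensional ℝ E]
    (cov : CovariantDerivative I E (fun x : M ↦ TangentSpace I x))
    (hJ : UniqueDiffWithinAt ℝ J t)
    (hγ : MDifferentiableWithinAt 𝓘(ℝ, ℝ) I γ J t) (ht : t ∈ J)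
    (hX : ∀ i, MDifferentiableAt I I.tangent (fun y ↦ (⟨y, X i y⟩ : TangentBundle I M)) (γ t))
    (hc : ∀ i, HasDerivWithinAt (c i) (c' i) J t)
    (hY : ∀ s ∈ J, Y s = ∑ i, c i s • X i (γ s)) :
    covDerivAlong cov γ J Y t
      = ∑ i, (c' i • X i (γ t) + c i t • cov (X i) (γ t) (velocityWithin γ J t)) := by
  let e := trivializationAt E (fun x : M ↦ TangentSpace I x) (γ t)
  let b := Module.finBasis ℝ E
  have hmem : γ t ∈ e.baseSet := FiberBundle.mem_baseSet_trivializationAt' (γ t)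
  set v := velocityWithin (I := I) γ J t
  -- coordinates of the fields `X i` in the chart at `γ t`
  let a i k (x : M) : ℝ := e.localFrameCoeff I b k x (X i x)
  have ha i k : MDifferentiableAt I 𝓘(ℝ, ℝ) (a i k) (γ t) :=
    mdifferentiableAt_localFrameCoeff b hmem (hX i) k
  have hs k : MDifferentiableAt I I.tangent
      (fun y ↦ (⟨y, e.localFrame b k y⟩ : TangentBundle I M)) (γ t) :=
    (contMDiffAt_localFrame_of_mem 1 e b k hmem).mdifferentiableAt one_ne_zero
  have haγ i k : HasDerivWithinAt (fun s ↦ a i k (γ s)) ((d% (a i k) (γ t)) v) J t := by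
    have h : HasFDerivWithinAt (fun s ↦ a i k (γ s))
        ((d% (a i k) (γ t)).comp (mfderivWithin 𝓘(ℝ, ℝ) I γ J t) : ℝ →L[ℝ] ℝ) J t :=
      ((ha i k).hasMFDerivAt.comp_hasMFDerivWithinAt t hγ.hasMFDerivWithinAt).hasFDerivWithinAt
    exact h.hasDerivWithinAt
  have hYk k : derivWithin (fun s ↦ e.localFrameCoeff I b k (γ s) (Y s)) J t
      = ∑ i, (c' i * a i k (γ t) + c i t * (d% (a i k) (γ t)) v) := by
    refine HasDerivWithinAt.derivWithin ?_ hJ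
    refine (HasDerivWithinAt.fun_sum fun i _ ↦ (hc i).mul (haγ i k)).congr_of_mem
      (fun s hs ↦ ?_) ht
    simp [hY s hs, a]
  -- `∇` depends only on the germ of `X i`, which is the coordinate expression near `γ t`
  have hcov i : cov (X i) (γ t) v
      = ∑ k, (a i k (γ t) • cov (e.localFrame b k) (γ t) v
        + (d% (a i k) (γ t)) v • e.localFrame b k (γ t)) := by
    rw [← cov.sum_smul_apply Finset.univ (fun k _ ↦ ha i k) (fun k _ ↦ hs k)]
    refine congr($(cov.isCovariantDerivativeOnUniv.congr_of_eventuallyEq (hX i)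
      (.sum_section fun k _ ↦ (ha i k).smul_section (hs k)) Filter.univ_mem
      (e.eventually_eq_localFrame_sum_coeff_smul b hmem)) v)
  have hXi i : X i (γ t) = ∑ k, a i k (γ t) • e.localFrame b k (γ t) :=
    e.eq_sum_localFrameCoeff_smul hmem
  change ∑ k, (derivWithin (fun s ↦ e.localFrameCoeff I b k (γ s) (Y s)) J t
      • e.localFrame b k (γ t) + e.localFrameCoeff I b k (γ t) (Y t)
      • cov (e.localFrame b k) (γ t) v) = _
  have hYt k : e.localFrameCoeff I b k (γ t) (Y t) = ∑ i, c i t * a i k (γ t) := by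
    simp [hY t ht, a]
  simp only [hYk, hYt, hcov, hXi, Finset.sum_smul, Finset.smul_sum, ← Finset.sum_add_distrib]
  rw [Finset.sum_comm]
  refine Finset.sum_congr rfl fun i _ ↦ Finset.sum_congr rfl fun k _ ↦ ?_
  module

end CovariantDerivativeAlong

/-! ### The Levi-Civita connection on left-invariant vector fields -/

section LeftInvariantFrame

variable {E : Type*} [NormedAddCommGroup E] [NormedSpace ℝ E]
  {H : Type*} [TopologicalSpace H] {I : ModelWithCorners ℝ E H}
  {G : Type*} [TopologicalSpace G] [ChartedSpace H G] [Group G]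

theorem mulInvariantVectorField_sum {ι : Type*} (s : Finset ι) (c : ι → ℝ)
    (v : ι → GroupLieAlgebra I G) (h : G) :
    mulInvariantVectorField (∑ i ∈ s, c i • v i) h
      = ∑ i ∈ s, c i • mulInvariantVectorField (v i) h := by
  simp only [mulInvariantVectorField]
  exact (map_sum _ _ _).trans (Finset.sum_congr rfl fun i _ ↦ map_smul _ _ _)

variable [LieGroup I ∞ G]

theorem lieGroup_minSmoothness : LieGroup I (minSmoothness ℝ 3) G :=
  LieGroup.of_le (n := ∞) (by simp; exact ENat.LEInfty.out)

theorem mdifferentiableAt_leftInvariant (x : GroupLieAlgebra I G) (h : G) :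
    MDifferentiableAt I I.tangent
      (fun y ↦ (⟨y, mulInvariantVectorField x y⟩ : TangentBundle I G)) h :=
  have : LieGroup I (minSmoothness ℝ 3) G := lieGroup_minSmoothness
  mdifferentiableAt_mulInvariantVectorField x

theorem isInvertible_mfderiv_mul_left (h : G) :
    (mfderiv I I (fun y : G ↦ h * y) 1).IsInvertible := by
  have hd (a x : G) : MDifferentiableAt I I (fun y : G ↦ a * y) x :=
    (contMDiff_mul_left (I := I) (n := ∞)).contMDiffAt.mdifferentiableAt (by simp)
  have hl : (fun y : G ↦ h⁻¹ * y) ∘ (fun y : G ↦ h * y) = id := by ext; simp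
  have hr : (fun y : G ↦ h * y) ∘ (fun y : G ↦ h⁻¹ * y) = id := by ext; simp
  refine .of_inverse (g := mfderiv I I (fun y : G ↦ h⁻¹ * y) (h * 1)) ?_ ?_
  · have := mfderiv_comp (I' := I) (h * 1) (hd h (h⁻¹ * (h * 1))) (hd h⁻¹ (h * 1))
    rw [hr, mfderiv_id, inv_mul_cancel_left] at this
    exact this.symm
  · have := mfderiv_comp (I' := I) 1 (hd h⁻¹ (h * 1)) (hd h 1)
    rw [hl, mfderiv_id] at this
    exact this.symm

theorem maurerCartan_mulInvariantVectorField (h : G) (x : GroupLieAlgebra I G) :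
    maurerCartan h (mulInvariantVectorField x h) = x :=
  (isInvertible_mfderiv_mul_left h).inverse_apply_eq.2 rfl

theorem mulInvariantVectorField_maurerCartan (h : G) (v : TangentSpace I h) :
    mulInvariantVectorField (maurerCartan h v) h = v := by
  have hinv (w : TangentSpace I (h * 1)) : mfderiv I I (fun y : G ↦ h * y) 1
      ((mfderiv I I (fun y : G ↦ h * y) 1).inverse w) = w :=
    ((isInvertible_mfderiv_mul_left h).inverse_apply_eq.1 rfl).symm
  exact hinv v

variable {g : ContMDiffRiemannianMetric I ∞ E (fun x : G ↦ TangentSpace I x)}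

theorem IsLeftInvariantMetric.inner_mulInvariantVectorField (hg : IsLeftInvariantMetric g)
    (h : G) (x y : GroupLieAlgebra I G) :
    g.inner h (mulInvariantVectorField x h) (mulInvariantVectorField y h) = g.inner 1 x y := by
  rw [← hg 1 h x y]
  -- `mulInvariantVectorField` identifies `T_{h * 1} G` with `T_h G`
  have key (k : G) (hk : k = h * 1) (u v : E) :
      (g.inner k : E →L[ℝ] E →L[ℝ] ℝ) u v = (g.inner (h * 1) : E →L[ℝ] E →L[ℝ] ℝ) u v := by
    rw [hk]
  exact key h (mul_one h).symm _ _

variable [FiniteDimensional ℝ E]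
  {cov : CovariantDerivative I E (fun x : G ↦ TangentSpace I x)}

/-- Vanishing of the torsion, evaluated on left-invariant vector fields. -/
theorem IsLeviCivita.sub_eq_mulInvariantVectorField_lie (hcov : IsLeviCivita g cov) (h : G)
    (x y : GroupLieAlgebra I G) :
    cov (mulInvariantVectorField y) h (mulInvariantVectorField x h)
      - cov (mulInvariantVectorField x) h (mulInvariantVectorField y h)
      = mulInvariantVectorField ⁅x, y⁆ h := by
  have : CompleteSpace E := FiniteDimensional.complete ℝ E
  have : LieGroup I (minSmoothness ℝ 3) G := lieGroup_minSmoothness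
  rw [cov.torsion_eq_zero_iff.1 hcov.torsion_eq_zero (mdifferentiableAt_leftInvariant x h)
    (mdifferentiableAt_leftInvariant y h), GroupLieAlgebra.bracket_def,
    mulInvariantVector_mlieBracket]

/-- For each `v`, the operator `∇_v` is skew-symmetric on left-invariant vector fields, since their
inner products are constant functions. -/
theorem IsLeviCivita.inner_add_inner_mulInvariantVectorField (hcov : IsLeviCivita g cov)
    (hg : IsLeftInvariantMetric g) (h : G) (v : TangentSpace I h) (y z : GroupLieAlgebra I G) :
    g.inner h (cov (mulInvariantVectorField y) h v) (mulInvariantVectorField z h)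
      + g.inner h (mulInvariantVectorField y h) (cov (mulInvariantVectorField z) h v) = 0 := by
  rw [← hcov.metric h v _ _ (mdifferentiableAt_leftInvariant y h)
    (mdifferentiableAt_leftInvariant z h)]
  simp only [hg.inner_mulInvariantVectorField, mvfderiv_const]
  rfl

/-- The Levi-Civita connection of a left-invariant metric preserves left-invariance, and acts on the
Lie algebra as `α`. -/
theorem IsLeviCivita.cov_mulInvariantVectorField (hcov : IsLeviCivita g cov)
    (hg : IsLeftInvariantMetric g) (h : G) (x y : GroupLieAlgebra I G) :
    cov (mulInvariantVectorField y) h (mulInvariantVectorField x h)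
      = mulInvariantVectorField (reducedConnection g x y) h := by
  -- `D x y ∈ 𝔤` is the value at `h` of `∇_{X_x} X_y`, translated back to the identity
  set D : GroupLieAlgebra I G → GroupLieAlgebra I G → GroupLieAlgebra I G := fun x y ↦
    maurerCartan h (cov (mulInvariantVectorField y) h (mulInvariantVectorField x h))
  have hcovD x y : cov (mulInvariantVectorField y) h (mulInvariantVectorField x h)
      = mulInvariantVectorField (D x y) h := (mulInvariantVectorField_maurerCartan h _).symm
  have hskew u v w : g.inner 1 (D u v) w + g.inner 1 v (D u w) = 0 := by
    have := hcov.inner_add_inner_mulInvariantVectorField hg h (mulInvariantVectorField u h) v w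
    rwa [hcovD, hcovD, hg.inner_mulInvariantVectorField, hg.inner_mulInvariantVectorField] at this
  have htor u v w : g.inner 1 (D u v) w - g.inner 1 (D v u) w = g.inner 1 ⁅u, v⁆ w := by
    have := congr(g.inner h $(hcov.sub_eq_mulInvariantVectorField_lie h u v)
      (mulInvariantVectorField w h))
    rw [map_sub, sub_apply, hcovD, hcovD] at this
    simpa only [hg.inner_mulInvariantVectorField] using this
  -- the Koszul formula, without the derivatives of the constant functions `⟪X_u, X_v⟫`
  have hkoszul z : g.inner 1 (D x y) z = g.inner 1 (reducedConnection g x y) z := by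
    have hα : g.inner 1 (reducedConnection g x y) z
        = 1 / 2 * (g.inner 1 ⁅x, y⁆ z - g.inner 1 y ⁅x, z⁆ - g.inner 1 x ⁅y, z⁆) := by
      rw [← inner_adStar g x y z, ← inner_adStar g y x z, reducedConnection]
      simp only [map_smul, map_sub, smul_apply, sub_apply, smul_eq_mul]
    rw [hα, g.symm 1 y, g.symm 1 x]
    linear_combination (1 / 2) * (htor x y z - htor x z y - htor y z x + hskew x y z
      + hskew y x z - hskew z x y + g.symm 1 (D x z) y + g.symm 1 (D y z) x - g.symm 1 (D z y) x)
  rw [hcovD]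
  congr 1
  by_contra hne
  refine (g.pos 1 _ (sub_ne_zero.2 hne)).ne' ?_
  have hzero := sub_eq_zero.2 (hkoszul (D x y - reducedConnection g x y))
  rwa [← sub_apply, ← map_sub] at hzero

end LeftInvariantFrame

/-! ### Vector fields along a curve in a left-invariant frame -/

section ParallelTransport

variable {E : Type*} [NormedAddCommGroup E] [NormedSpace ℝ E] [FiniteDimensional ℝ E]
  {H : Type*} [TopologicalSpace H] {I : ModelWithCorners ℝ E H}
  {G : Type*} [TopologicalSpace G] [ChartedSpace H G] [Group G] [LieGroup I ∞ G]
  {g : ContMDiffRiemannianMetric I ∞ E (fun x : G ↦ TangentSpace I x)}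
  {cov : CovariantDerivative I E (fun x : G ↦ TangentSpace I x)}
  {γ : ℝ → G} {J : Set ℝ} {t : ℝ} {Y : ∀ t : ℝ, TangentSpace I (γ t)}

/-- If a vector field `Y` along a curve is differentiable, then so is its transport to the Lie
algebra: by left-invariance, its coordinates in the basis dual to `(bᵢ)` are the inner products of
`Y` with the left-invariant fields of the `bᵢ`. -/
theorem IsLeftInvariantMetric.differentiableWithinAt_maurerCartan
    (hg : IsLeftInvariantMetric g)
    (hY : MDifferentiableWithinAt 𝓘(ℝ, ℝ) I.tangent
      (fun t ↦ (⟨γ t, Y t⟩ : TangentBundle I G)) J t) :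
    DifferentiableWithinAt ℝ (fun s ↦ maurerCartan (γ s) (Y s)) J t := by
  classical
  have : FiniteDimensional ℝ (GroupLieAlgebra I G) := inferInstanceAs (FiniteDimensional ℝ E)
  have hγ : MDifferentiableWithinAt 𝓘(ℝ, ℝ) I γ J t :=
    ((mdifferentiableWithinAt_totalSpace _ _).1 hY).1
  let b := Module.finBasis ℝ (GroupLieAlgebra I G)
  let d := (lieInner g).dualBasis (lieInner_nondegenerate g) b
  -- the same vectors in the normed space `E`, as `TangentSpace` carries no norm
  let d' : Fin _ → E := fun i ↦ d i
  have hcoord i : DifferentiableWithinAt ℝ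
      (fun s ↦ g.inner (γ s) (Y s) (mulInvariantVectorField (b i) (γ s))) J t := by
    have hX : MDifferentiableWithinAt 𝓘(ℝ, ℝ) I.tangent
        (fun s ↦ (⟨γ s, mulInvariantVectorField (b i) (γ s)⟩ : TangentBundle I G)) J t :=
      (mdifferentiableAt_leftInvariant (b i) (γ t)).comp_mdifferentiableWithinAt t hγ
    have hg' : MDifferentiableWithinAt 𝓘(ℝ, ℝ) (I.prod 𝓘(ℝ, E →L[ℝ] E →L[ℝ] ℝ))
        (fun s ↦ TotalSpace.mk' (E →L[ℝ] E →L[ℝ] ℝ)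
          (E := fun x : G ↦ TangentSpace I x →L[ℝ] TangentSpace I x →L[ℝ] ℝ)
          (γ s) (g.inner (γ s))) J t :=
      (g.contMDiff.contMDiffAt.mdifferentiableAt (by simp)).comp_mdifferentiableWithinAt t hγ
    have h := MDifferentiableWithinAt.clm_bundle_apply₂ (F₁ := E) (F₂ := E)
      (E₃ := Bundle.Trivial G ℝ) (F₃ := ℝ) hg' hY hX
    exact mdifferentiableWithinAt_iff_differentiableWithinAt.1
      ((mdifferentiableWithinAt_totalSpace _ _).1 h).2
  have hsum : DifferentiableWithinAt ℝ (fun s ↦ ∑ i,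
      g.inner (γ s) (Y s) (mulInvariantVectorField (b i) (γ s)) • d' i) J t :=
    .fun_sum fun i _ ↦ (hcoord i).smul_const _
  have hrepr s : maurerCartan (γ s) (Y s)
      = ∑ i, g.inner (γ s) (Y s) (mulInvariantVectorField (b i) (γ s)) • d i := by
    nth_rw 1 [← d.sum_repr (maurerCartan (γ s) (Y s))]
    refine Finset.sum_congr rfl fun i _ ↦ ?_
    nth_rw 2 [← mulInvariantVectorField_maurerCartan (γ s) (Y s)]
    rw [hg.inner_mulInvariantVectorField]
    exact congrArg (· • d i) (LinearMap.BilinForm.dualBasis_repr_apply ..)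
  rw [funext hrepr]
  exact hsum

/-- If the transport `ζ` of `Y` to the Lie algebra has derivative `ζ'`, then `Y` is differentiable
and its covariant derivative is the left translate of `ζ' + α(ω, ζ)`. -/
theorem covDerivAlong_eq_mulInvariantVectorField (hcov : IsLeviCivita g cov)
    (hg : IsLeftInvariantMetric g) (hJ : UniqueDiffWithinAt ℝ J t)
    (hγ : MDifferentiableWithinAt 𝓘(ℝ, ℝ) I γ J t) (ht : t ∈ J) {ζ' : GroupLieAlgebra I G}
    (hζ : HasDerivWithinAt (fun s ↦ maurerCartan (γ s) (Y s)) ζ' J t) :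
    MDifferentiableWithinAt 𝓘(ℝ, ℝ) I.tangent (fun t ↦ (⟨γ t, Y t⟩ : TangentBundle I G)) J t ∧
    covDerivAlong cov γ J Y t = mulInvariantVectorField
      (ζ' + reducedConnection g (maurerCartan (γ t) (velocityWithin γ J t))
        (maurerCartan (γ t) (Y t))) (γ t) := by
  have : FiniteDimensional ℝ (GroupLieAlgebra I G) := inferInstanceAs (FiniteDimensional ℝ E)
  let b := Module.finBasis ℝ (GroupLieAlgebra I G)
  let c i (s : ℝ) : ℝ := b.repr (maurerCartan (γ s) (Y s)) i
  have hc i : HasDerivWithinAt (c i) (b.repr ζ' i) J t := by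
    let l : E →L[ℝ] ℝ := LinearMap.toContinuousLinearMap (b.coord i : E →ₗ[ℝ] ℝ)
    exact l.hasFDerivAt.comp_hasDerivWithinAt (F := E) t hζ
  have hY s : Y s = ∑ i, c i s • mulInvariantVectorField (b i) (γ s) := by
    rw [← mulInvariantVectorField_sum, b.sum_repr, mulInvariantVectorField_maurerCartan]
  have hX i := mdifferentiableAt_leftInvariant (I := I) (b i) (γ t)
  refine ⟨mdifferentiableWithinAt_of_eq_sum hγ ht hX
    (fun i ↦ (hc i).differentiableWithinAt) fun s _ ↦ hY s, ?_⟩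
  set v := velocityWithin (I := I) γ J t
  -- the coefficients are frozen at time `t`, so the Leibniz rule has no derivative terms
  have hcovY : ∑ i, c i t • cov (mulInvariantVectorField (b i)) (γ t) v
      = cov (mulInvariantVectorField (maurerCartan (γ t) (Y t))) (γ t) v := by
    have h := cov.sum_smul_apply Finset.univ (f := fun i _ ↦ c i t)
      (fun i _ ↦ mdifferentiableAt_const) (fun i _ ↦ hX i) v
    simp only [mvfderiv_const, zero_apply, zero_smul, add_zero] at h
    rw [← h]
    congr! 2
    ext y
    rw [← mulInvariantVectorField_sum, b.sum_repr]
  rw [covDerivAlong_eq_sum cov hJ hγ ht hX hc fun s _ ↦ hY s, Finset.sum_add_distrib, hcovY,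
    ← mulInvariantVectorField_sum, b.sum_repr, mulInvariantVectorField_add, Pi.add_apply,
    ← hcov.cov_mulInvariantVectorField hg, mulInvariantVectorField_maurerCartan]

end ParallelTransport

theorem theorem1
    {E : Type*} [NormedAddCommGroup E] [NormedSpace ℝ E] [FiniteDimensional ℝ E]
    {H : Type*} [TopologicalSpace H] (I : ModelWithCorners ℝ E H) [I.Boundaryless]
    {G : Type*} [TopologicalSpace G] [ChartedSpace H G] [Group G] [LieGroup I ∞ G]
    (g : ContMDiffRiemannianMetric I ∞ E (fun x : G ↦ TangentSpace I x))
    (hg : IsLeftInvariantMetric g)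
    (cov : CovariantDerivative I E (fun x : G ↦ TangentSpace I x)) (hcov : IsLeviCivita g cov)
    (J : Set ℝ) (hJ : J.OrdConnected) (hJ' : J.Nontrivial)
    (γ : ℝ → G) (hγ : ContMDiffOn 𝓘(ℝ, ℝ) I ∞ γ J)
    (Y : ∀ t : ℝ, TangentSpace I (γ t)) :
    IsParallelAlong cov γ J Y ↔
      ∀ t ∈ J, HasDerivWithinAt (fun s ↦ maurerCartan (γ s) (Y s))
        (-reducedConnection g (maurerCartan (γ t) (velocityWithin γ J t))
          (maurerCartan (γ t) (Y t))) J t := by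
  have hJu : UniqueDiffOn ℝ J := uniqueDiffOn_convex hJ.convex
    (hJ.convex.nontrivial_iff_nonempty_interior.1 hJ')
  have hγd t (ht : t ∈ J) : MDifferentiableWithinAt 𝓘(ℝ, ℝ) I γ J t :=
    (hγ t ht).mdifferentiableWithinAt (by simp)
  constructor
  · intro hY t ht
    have hζ : HasDerivWithinAt (fun s ↦ maurerCartan (γ s) (Y s))
        (derivWithin (fun s ↦ maurerCartan (γ s) (Y s)) J t) J t :=
      DifferentiableWithinAt.hasDerivWithinAt (F := E)
        (hg.differentiableWithinAt_maurerCartan (hY.mdifferentiableOn t ht))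
    have h := (covDerivAlong_eq_mulInvariantVectorField hcov hg (hJu t ht) (hγd t ht) ht hζ).2
    rw [hY.covDerivAlong_eq_zero t ht] at h
    have h0 := congrArg (maurerCartan (γ t)) h
    rw [maurerCartan_mulInvariantVectorField] at h0
    rwa [eq_neg_of_add_eq_zero_left (h0.symm.trans (map_zero _))] at hζ
  · intro hζ
    refine ⟨fun t ht ↦ (covDerivAlong_eq_mulInvariantVectorField hcov hg (hJu t ht) (hγd t ht)
      ht (hζ t ht)).1, fun t ht ↦ ?_⟩
    rw [(covDerivAlong_eq_mulInvariantVectorField hcov hg (hJu t ht) (hγd t ht) ht (hζ t ht)).2,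
      neg_add_cancel]
    exact map_zero _
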